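/- Let $V$ be a finite set, $w\colon V\times V\to[0,\infty)$ and $k\ge 1$. The program \textsc{KMed} minimizes $\sum_{i,j\in V} w_{ij}z_{ij}$ over $z\in\mathbb{R}^{V\times V}$ subject to $\sum_j z_{ij}=1$ for all $i$, $\sum_j z_{jj}\le k$, $z_{ij}\le z_{jj}$ for all $i,j$, and $z_{ij}\in\{0,1\}$; its linear relaxation \textsc{LinKMed} replaces the last constraint by $z_{ij}\ge 0$. The clusters of a feasible point $z$ of \textsc{KMed} are the nonempty sets $\{i : z_{ij}=1\}$, $j\in V$. Let $d\ge 2$ and $\varepsilon\ge 0$. For integers $k\ge 2$ and $n\ge 1$ let $\mathcal{R}(d,k,n,\varepsilon)$ denote the following assertion. For all $k$ unit balls in $\mathbb{R}^d$ whose centers $c_1,\dots,c_k$ are pairwise at distance at least $3.75+\varepsilon$, and for all probability distributions $\mu_1,\dots,\mu_k$ on $\mathbb{R}^d$ such that $\mu_a$ is spherically symmetric about $c_a$, is supported in the unit ball about $c_a$, has no atom at $c_a$, and satisfies $\mu_a(\{x : \|x-c_a\|\ge r\})\le 1-r^2$ for $0\le r\le 1$: if $n$ points are drawn from each $\mu_a$,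 all $kn$ points being independent, and $w_{ij}=\|x_i-x_j\|^2$ is the squared Euclidean distance of the points with indices $i$ and $j$, then with probability exceeding $1-4k/n$ the programs \textsc{KMed} and \textsc{LinKMed} each have a unique optimal solution, these two solutions coincide, and their clusters are exactly the $k$ sets of points drawn from the same ball. Then the following hold. (a) There is a $k\ge 2$ such that $\mathcal{R}(d,k,n,\varepsilon)$ holds for all sufficiently large $n$ (how large may depend on $d$ and $\varepsilon$). (b) $\mathcal{R}(d,k,n,\varepsilon)$ holds whenever $k\ge 2$, $d\le \frac98\,\frac{n-2}{\log n}$, and one of the following is satisfied: $n\ge 10^6$ and $k=2$; or $\varepsilon\ge 0.05$, $n\ge 10^7$ and $k\le 3$; or $\varepsilon\ge 0.15$, $n\ge 10^4$ and $k=2$; or $\varepsilon\ge 0.15$, $n\ge 10^7$ and $k\le 10$. -/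

import Mathlib

open MeasureTheory

noncomputable section

/-- The linear objective `∑ i, ∑ j, w i j * z i j` of `k`-medoids clustering. -/
def medoidCost {V : Type*} [Fintype V] (w z : V → V → ℝ) : ℝ :=
  ∑ i, ∑ j, w i j * z i j

/-- Feasible points of the linear programming relaxation `LinKMed`. -/
def linKMedFeasible (V : Type*) [Fintype V] (k : ℕ) : Set (V → V → ℝ) :=
  {z | (∀ i, ∑ j, z i j = 1) ∧ ∑ j, z j j ≤ (k : ℝ) ∧ (∀ i j, z i j ≤ z j j) ∧
    ∀ i j, 0 ≤ z i j}

/-- Feasible points of the binary integer program `KMed`. -/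
def kMedFeasible (V : Type*) [Fintype V] (k : ℕ) : Set (V → V → ℝ) :=
  {z | (∀ i, ∑ j, z i j = 1) ∧ ∑ j, z j j ≤ (k : ℝ) ∧ (∀ i j, z i j ≤ z j j) ∧
    ∀ i j, z i j = 0 ∨ z i j = 1}

/-- `z` is a minimizer over the feasible set `F` of the `k`-medoids objective. -/
def IsOptimalSolution {V : Type*} [Fintype V] (w : V → V → ℝ) (F : Set (V → V → ℝ))
    (z : V → V → ℝ) : Prop :=
  z ∈ F ∧ ∀ z' ∈ F, medoidCost w z ≤ medoidCost w z'

/-- `z` is the only minimizer over the feasible set `F` of the `k`-medoids objective. -/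
def IsUniqueOptimalSolution {V : Type*} [Fintype V] (w : V → V → ℝ) (F : Set (V → V → ℝ))
    (z : V → V → ℝ) : Prop :=
  IsOptimalSolution w F z ∧ ∀ z', IsOptimalSolution w F z' → z' = z

/-- The points of each ball form exactly one cluster: two points `(a, i)` and `(b, j)` (point `i` of
ball `a`, point `j` of ball `b`) share a medoid iff they come from the same ball. -/
def ClustersAreBalls {k n : ℕ} (z : Fin k × Fin n → Fin k × Fin n → ℝ) : Prop :=
  ∀ p q, (∃ m, z p m = 1 ∧ z q m = 1) ↔ p.1 = q.1

/-- Squared Euclidean dissimilarities of a family of points. -/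
def sqDist {d : ℕ} {V : Type*} (x : V → EuclideanSpace ℝ (Fin d)) (i j : V) : ℝ :=
  ‖x i - x j‖ ^ 2

/-- The laws points are drawn from: spherically symmetric about `c`, supported in the unit ball
about `c`, with the radial tail bound `1 - r ^ 2`, and without an atom at `c`. -/
structure IsBallLaw {d : ℕ} (c : EuclideanSpace ℝ (Fin d))
    (μ : Measure (EuclideanSpace ℝ (Fin d))) : Prop where
  isProb : IsProbabilityMeasure μ
  isotropic : ∀ U : EuclideanSpace ℝ (Fin d) ≃ₗᵢ[ℝ] EuclideanSpace ℝ (Fin d),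
    μ.map (fun x => c + U (x - c)) = μ
  supported : μ (Metric.closedBall c 1)ᶜ = 0
  tail : ∀ r : ℝ, 0 ≤ r → r ≤ 1 → μ.real {x | r ≤ ‖x - c‖} ≤ 1 - r ^ 2
  center_null : μ {c} = 0

/-- For all `k` unit balls in `ℝ^d` with centers at pairwise distance at least `R` and all admissible
laws (one for each ball), `n` independent points from each ball are such that, with probability
exceeding `1 - 4k/n`, `KMed` and `LinKMed` have the same unique optimal solution, whose clusters are
the balls. The product measure is the joint law of the `k * n` independent points. -/
def RecoversBalls (d k n : ℕ) (R : ℝ) : Prop :=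
  ∀ (c : Fin k → EuclideanSpace ℝ (Fin d)) (μ : Fin k → Measure (EuclideanSpace ℝ (Fin d))),
    (∀ a b, a ≠ b → R ≤ dist (c a) (c b)) → (∀ a, IsBallLaw (c a) (μ a)) →
      1 - 4 * (k : ℝ) / n <
        (Measure.pi (fun p : Fin k × Fin n => μ p.1)).real
          {x | ∃ z : Fin k × Fin n → Fin k × Fin n → ℝ,
            IsUniqueOptimalSolution (sqDist x) (kMedFeasible (Fin k × Fin n) k) z ∧
            IsUniqueOptimalSolution (sqDist x) (linKMedFeasible (Fin k × Fin n) k) z ∧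
            ClustersAreBalls z}

end

/-!
The proof is by a dual certificate for the relaxation. Let `M a` be the sample point of ball `a`
closest to the empirical mean of that ball. The dual variable of a point `p` of ball `a` is
`β + w p (M a)` with `β = 3 + 6 η`, and the dual variable of the constraint on the number of medoids
is `n β`. Optimality and uniqueness of the planted solution follow
(`eq_ballAssignment_of_cost_le`) once `∑ p, (β + w p (M _) - w p q)₊ < n β` for each `q` that is not
one of the medoids, with equality at the medoids.

For `q` in ball `b`, the points of ball `b` themselves contribute exactly
`n β - n (‖q - e‖² - ‖M b - e‖²)`, where `e` is the empirical mean: with this choice of dual variables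
all the positive parts are attained, because two points of a unit ball are at distance at most
`r + 1`, where `r` is the radius of the first. A point of another ball, at radius `r`, contributes at
most `3 + r² - (R - 1 - r)²` up to terms of order `η`, where `R` is the separation. This is positive
only if `q` is near the boundary of its ball and `r` is near `1`. The tail bound `1 - r²` keeps the
proportion of points with such `r` small, so the total contribution of the other balls stays below
the loss `‖q - e‖² - ‖M b - e‖²`, which is then bounded away from `0`. If `q` is
not near the boundary, the other balls contribute nothing, and the loss is positive because the
medoid is unique. This is `recovery_of_isWellSpread`.

The conditions on the sample fail in one ball with probability at most `4 exp (-n η² / 2)`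
(`IsBallLaw.measure_not_isWellSpread_le`). The empirical mean is controlled independently of the
dimension by the inequality `cosh ‖u + v‖ + cosh ‖u - v‖ ≤ 2 cosh ‖u‖ cosh ‖v‖`, the proportion of
points far from the center by Hoeffding's inequality. Ties between candidate medoids have
probability zero because hyperplanes are null sets (`IsBallLaw.measure_hyperplane`).
-/

/-! ### The dual certificate -/

/-- The integral point in which every point of ball `a` is assigned to the medoid `(a, m a)`. -/
def ballAssignment {k n : ℕ} (m : Fin k → Fin n) (p q : Fin k × Fin n) : ℝ :=
  if q = (p.1, m p.1) then 1 else 0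

theorem kMedFeasible_subset_linKMedFeasible {V : Type*} [Fintype V] {k : ℕ} :
    kMedFeasible V k ⊆ linKMedFeasible V k := fun z ⟨h1, h2, h3, h4⟩ =>
  ⟨h1, h2, h3, fun i j => by rcases h4 i j with h | h <;> simp [h]⟩

theorem ballAssignment_mem_kMedFeasible {k n : ℕ} (m : Fin k → Fin n) :
    ballAssignment m ∈ kMedFeasible (Fin k × Fin n) k := by
  refine ⟨fun p => by simp [ballAssignment], ?_, ?_, fun p q => ?_⟩
  · rw [Fintype.sum_prod_type]
    simp [ballAssignment]
  · rintro p ⟨b, j⟩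
    simp only [ballAssignment, Prod.mk.injEq]
    split_ifs <;> simp_all
  · unfold ballAssignment
    split_ifs <;> simp

theorem clustersAreBalls_ballAssignment {k n : ℕ} (m : Fin k → Fin n) :
    ClustersAreBalls (ballAssignment m) := by
  intro p q
  simp only [ballAssignment, ite_eq_left_iff, zero_ne_one, imp_false, not_not]
  constructor
  · rintro ⟨r, h1, h2⟩
    rw [h1] at h2
    exact (Prod.mk.inj h2).1
  · intro h
    exact ⟨_, rfl, by rw [h]⟩

theorem medoidCost_ballAssignment {k n : ℕ} (m : Fin k → Fin n)
    (w : Fin k × Fin n → Fin k × Fin n → ℝ) :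
    medoidCost w (ballAssignment m) = ∑ p, w p (p.1, m p.1) := by
  simp [medoidCost, ballAssignment]

/-- Weak duality with complementary slackness. The dual variable of the point `p` is its distance to
its medoid plus `β`, and the dual variable of the constraint on the number of medoids is `n * β`.
A dual solution that is tight exactly at the medoids forces every optimal point of the relaxation to
be the integral one. -/
theorem eq_ballAssignment_of_cost_le {k n : ℕ} {w : Fin k × Fin n → Fin k × Fin n → ℝ}
    {m : Fin k → Fin n} {β : ℝ} (hβ : 0 < β) (hn : 0 < n)
    (own : ∀ a i j, w (a, i) (a, j) - w (a, i) (a, m a) ≤ β)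
    (other : ∀ a b, a ≠ b → ∀ i, β + w (a, i) (a, m a) < w (a, i) (b, m b))
    (nonmedoid : ∀ b j, j ≠ m b →
      ∑ a ∈ Finset.univ.erase b, ∑ i, max (β + w (a, i) (a, m a) - w (a, i) (b, j)) 0 <
        ∑ i, (w (b, i) (b, j) - w (b, i) (b, m b)))
    {z : Fin k × Fin n → Fin k × Fin n → ℝ} (hz : z ∈ linKMedFeasible (Fin k × Fin n) k) :
    medoidCost w (ballAssignment m) ≤ medoidCost w z ∧
      (medoidCost w z ≤ medoidCost w (ballAssignment m) → z = ballAssignment m) := by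
  obtain ⟨z1, zk, zle, z0⟩ := hz
  set α : Fin k × Fin n → ℝ := fun p => β + w p (p.1, m p.1) with hα
  set φ : Fin k × Fin n → ℝ := fun q => ∑ p, max (α p - w p q) 0 with hφ
  have φsplit : ∀ b j, φ (b, j) = n * β - ∑ i, (w (b, i) (b, j) - w (b, i) (b, m b)) +
      ∑ a ∈ Finset.univ.erase b, ∑ i, max (β + w (a, i) (a, m a) - w (a, i) (b, j)) 0 := by
    intro b j
    simp only [hφ, hα]
    rw [Fintype.sum_prod_type, ← Finset.add_sum_erase _ _ (Finset.mem_univ b)]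
    congr 1
    rw [Finset.sum_congr rfl (g := fun i => β - (w (b, i) (b, j) - w (b, i) (b, m b)))]
    · simp [Finset.sum_sub_distrib]
    · intro i _
      rw [max_eq_left]
      · ring
      · linarith [own b i j]
  have φmed : ∀ b, φ (b, m b) = n * β := by
    intro b
    rw [φsplit, Finset.sum_eq_zero (s := Finset.univ.erase b)]
    · simp
    · intro a ha
      refine Finset.sum_eq_zero fun i _ => max_eq_right ?_
      linarith [other a b (Finset.ne_of_mem_erase ha) i]
  have φlt : ∀ b j, j ≠ m b → φ (b, j) < n * β := by
    intro b j hj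
    rw [φsplit]
    linarith [nonmedoid b j hj]
  have φle : ∀ q, φ q ≤ n * β := by
    rintro ⟨b, j⟩
    by_cases h : j = m b
    · rw [h, φmed]
    · exact (φlt b j h).le
  -- the three nonnegative defects whose sum is the duality gap `key`
  have gap1 : ∀ p q, 0 ≤ max (α p - w p q) 0 * z q q - (α p - w p q) * z p q := by
    intro p q
    have h1 : (α p - w p q) * z p q ≤ max (α p - w p q) 0 * z p q :=
      mul_le_mul_of_nonneg_right (le_max_left _ _) (z0 p q)
    have h2 : max (α p - w p q) 0 * z p q ≤ max (α p - w p q) 0 * z q q :=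
      mul_le_mul_of_nonneg_left (zle p q) (le_max_right _ _)
    linarith
  have gap2 : ∀ q, 0 ≤ (n * β - φ q) * z q q := fun q =>
    mul_nonneg (by linarith [φle q]) (z0 q q)
  have hu : 0 < n * β := by positivity
  have gap3 : 0 ≤ n * β * (k - ∑ q, z q q) := mul_nonneg hu.le (by linarith)
  have hsum1 : ∑ p, ∑ q, (α p - w p q) * z p q = ∑ p, α p - medoidCost w z := by
    simp only [medoidCost, sub_mul, Finset.sum_sub_distrib]
    congr 1
    refine Finset.sum_congr rfl fun p _ => ?_
    rw [← Finset.mul_sum, z1, mul_one]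
  have hsum2 : ∑ p, ∑ q, max (α p - w p q) 0 * z q q = ∑ q, φ q * z q q := by
    rw [Finset.sum_comm]
    simp only [hφ, Finset.sum_mul]
  have hcost : medoidCost w (ballAssignment m) = ∑ p, α p - k * (n * β) := by
    rw [medoidCost_ballAssignment]
    simp only [hα, Finset.sum_add_distrib]
    simp
    ring
  have key : (∑ p, ∑ q, (max (α p - w p q) 0 * z q q - (α p - w p q) * z p q)) +
      (∑ q, (n * β - φ q) * z q q) + n * β * (k - ∑ q, z q q) =
      medoidCost w z - medoidCost w (ballAssignment m) := by
    simp only [Finset.sum_sub_distrib, sub_mul (n * β), ← Finset.mul_sum]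
    rw [hsum1, hsum2, hcost]
    ring
  have g1 := Finset.sum_nonneg fun p (_ : p ∈ Finset.univ) =>
    Finset.sum_nonneg fun q (_ : q ∈ Finset.univ) => gap1 p q
  have g2 := Finset.sum_nonneg fun q (_ : q ∈ Finset.univ) => gap2 q
  refine ⟨by linarith, fun hle => ?_⟩
  have e2 : ∀ q, (n * β - φ q) * z q q = 0 := fun q =>
    (Finset.sum_eq_zero_iff_of_nonneg fun q _ => gap2 q).1 (by linarith) q (Finset.mem_univ q)
  have e1 : ∀ p q, max (α p - w p q) 0 * z q q - (α p - w p q) * z p q = 0 := by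
    intro p q
    have h := (Finset.sum_eq_zero_iff_of_nonneg fun p _ =>
      Finset.sum_nonneg fun q (_ : q ∈ Finset.univ) => gap1 p q).1 (by linarith) p
      (Finset.mem_univ p)
    exact (Finset.sum_eq_zero_iff_of_nonneg fun q _ => gap1 p q).1 h q (Finset.mem_univ q)
  have zzero : ∀ p q, q ≠ (p.1, m p.1) → z p q = 0 := by
    rintro ⟨a, i⟩ ⟨b, j⟩ hq
    by_cases hj : j = m b
    · subst hj
      have hab : a ≠ b := by
        rintro rfl
        exact hq rfl
      have hneg : α (a, i) - w (a, i) (b, m b) < 0 := by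
        have := other a b hab i
        simp only [hα]
        linarith
      have := e1 (a, i) (b, m b)
      rw [max_eq_right hneg.le, zero_mul, zero_sub, neg_eq_zero] at this
      exact (mul_eq_zero.1 this).resolve_left hneg.ne
    · have hzz : z (b, j) (b, j) = 0 :=
        (mul_eq_zero.1 (e2 (b, j))).resolve_left (by linarith [φlt b j hj])
      exact le_antisymm (hzz ▸ zle (a, i) (b, j)) (z0 _ _)
  funext p q
  unfold ballAssignment
  split_ifs with h
  · rw [h, ← z1 p, Finset.sum_eq_single (p.1, m p.1)]
    · exact fun q _ hq => zzero p q hq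
    · simp
  · exact zzero p q h

/-- Since the optimum of the relaxation is integral, it is also the optimum of `KMed`. -/
theorem isUniqueOptimalSolution_ballAssignment {k n : ℕ}
    {w : Fin k × Fin n → Fin k × Fin n → ℝ} {m : Fin k → Fin n}
    (h : ∀ z ∈ linKMedFeasible (Fin k × Fin n) k,
      medoidCost w (ballAssignment m) ≤ medoidCost w z ∧
      (medoidCost w z ≤ medoidCost w (ballAssignment m) → z = ballAssignment m)) :
    IsUniqueOptimalSolution w (kMedFeasible (Fin k × Fin n) k) (ballAssignment m) ∧
      IsUniqueOptimalSolution w (linKMedFeasible (Fin k × Fin n) k) (ballAssignment m) := by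
  have hm := ballAssignment_mem_kMedFeasible m
  have hs := @kMedFeasible_subset_linKMedFeasible (Fin k × Fin n) _ k
  exact ⟨⟨⟨hm, fun z hz => (h z (hs hz)).1⟩, fun z hz => (h z (hs hz.1)).2 (hz.2 _ hm)⟩,
    ⟨⟨hs hm, fun z hz => (h z hz).1⟩, fun z hz => (h z hz.1).2 (hz.2 _ (hs hm))⟩⟩

/-! ### Well-spread samples are recovered -/

/-- Sum of squared distances through the empirical mean `e`, up to a term that does not depend on
`y`. -/
theorem sum_norm_sub_sq_sub {E ι : Type*} [NormedAddCommGroup E] [InnerProductSpace ℝ E]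
    [Fintype ι] (x : ι → E) {e : E} (he : ∑ i, (x i - e) = 0) (y y' : E) :
    ∑ i, (‖x i - y‖ ^ 2 - ‖x i - y'‖ ^ 2) =
      Fintype.card ι * (‖y - e‖ ^ 2 - ‖y' - e‖ ^ 2) := by
  have h : ∀ i, ‖x i - y‖ ^ 2 - ‖x i - y'‖ ^ 2 =
      ‖y - e‖ ^ 2 - ‖y' - e‖ ^ 2 + 2 * inner ℝ (x i - e) (y' - y) := by
    intro i
    have h1 : x i - y = (x i - e) - (y - e) := by abel
    have h2 : x i - y' = (x i - e) - (y' - e) := by abel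
    have h3 : inner ℝ (x i - e) (y' - y) = inner ℝ (x i - e) (y' - e) - inner ℝ (x i - e) (y - e) := by
      rw [← inner_sub_right, sub_sub_sub_cancel_right]
    rw [h3, h1, h2, norm_sub_sq_real (x i - e) (y - e), norm_sub_sq_real (x i - e) (y' - e)]
    ring
  simp only [h, Finset.sum_add_distrib, ← Finset.mul_sum, ← sum_inner, he]
  simp [mul_sub]

/-- The deterministic conditions on the sample `x` from one ball under which recovery is proved:
the empirical mean of the ball is within `η` of its center `c`, some sample point is within `η` of `c`, at most a
proportion `f` of the points lie at distance `ρ` or more from `c`, and no two points have the same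
cost as a medoid of the ball. -/
structure IsWellSpread {E : Type*} [NormedAddCommGroup E] {n : ℕ} (η ρ f : ℝ) (c : E)
    (x : Fin n → E) : Prop where
  mem_ball : ∀ i, ‖x i - c‖ ≤ 1
  mean : ‖∑ i, (x i - c)‖ ≤ n * η
  near : ∃ i, ‖x i - c‖ ≤ η
  far : ((Finset.univ.filter fun i => ρ ≤ ‖x i - c‖).card : ℝ) ≤ n * f
  no_tie : ∀ i j, i ≠ j → ∑ l, (‖x l - x i‖ ^ 2 - ‖x l - x j‖ ^ 2) ≠ 0

/-- The certificate in the deterministic setting. The number `s` separates the candidates `q` too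
close to their center to be reached by other balls (`gain_neg`) from those for which the total gain
from the other balls is compared with the loss (`gain_lt`). By `gain_nonpos` only points at radius at
least `ρ` contribute to the gain. -/
theorem recovery_of_isWellSpread {d k n : ℕ} (hk : 1 ≤ k) {R η ρ s f : ℝ}
    (hη : 0 < η) (hηs : 3 * η ≤ s) (hρ : ρ ≤ 1) (hR : 2 < R) (hs : s ≤ 1)
    (gain_neg : 3 + 6 * η + (1 + 3 * η) ^ 2 < (R - 1 - s) ^ 2)
    (gain_nonpos : 3 + 6 * η + (ρ + 3 * η) ^ 2 ≤ (R - 1 - ρ) ^ 2)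
    (gain_pos : 0 ≤ 3 + 6 * η + (1 + 3 * η) ^ 2 - (R - 2) ^ 2)
    (gain_lt : (k - 1) * (f * (3 + 6 * η + (1 + 3 * η) ^ 2 - (R - 2) ^ 2)) <
      (s - η) ^ 2 - 4 * η ^ 2)
    {c : Fin k → EuclideanSpace ℝ (Fin d)} (hc : ∀ a b, a ≠ b → R ≤ dist (c a) (c b))
    {x : Fin k × Fin n → EuclideanSpace ℝ (Fin d)}
    (hx : ∀ a, IsWellSpread η ρ f (c a) fun i => x (a, i)) :
    ∃ z : Fin k × Fin n → Fin k × Fin n → ℝ,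
      IsUniqueOptimalSolution (sqDist x) (kMedFeasible (Fin k × Fin n) k) z ∧
      IsUniqueOptimalSolution (sqDist x) (linKMedFeasible (Fin k × Fin n) k) z ∧
      ClustersAreBalls z := by
  obtain ⟨i₀, -⟩ := (hx ⟨0, hk⟩).near
  have hn : 0 < n := i₀.pos
  have hn' : (0 : ℝ) < n := by exact_mod_cast hn
  have : Nonempty (Fin n) := ⟨i₀⟩
  -- the empirical means and the medoids
  set e : Fin k → EuclideanSpace ℝ (Fin d) :=
    fun a => c a + (n : ℝ)⁻¹ • ∑ i, (x (a, i) - c a) with he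
  have he0 : ∀ a, ∑ i, (x (a, i) - e a) = 0 := by
    intro a
    have : ∀ i, x (a, i) - e a = (x (a, i) - c a) - (n : ℝ)⁻¹ • ∑ i, (x (a, i) - c a) :=
      fun i => by simp only [he]; abel
    simp only [this]
    rw [Finset.sum_sub_distrib (s := Finset.univ) (f := fun i => x (a, i) - c a)]
    simp only [Finset.sum_const, Finset.card_univ, Fintype.card_fin]
    rw [← Nat.cast_smul_eq_nsmul ℝ, smul_smul, mul_inv_cancel₀ hn'.ne', one_smul, sub_self]
  have hec : ∀ a, ‖e a - c a‖ ≤ η := by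
    intro a
    simp only [he, add_sub_cancel_left, norm_smul, norm_inv, Real.norm_natCast]
    rw [inv_mul_le_iff₀ hn']
    exact (hx a).mean
  have hm : ∀ a, ∃ i, ∀ j, ‖x (a, i) - e a‖ ≤ ‖x (a, j) - e a‖ :=
    fun a => Finite.exists_min fun i => ‖x (a, i) - e a‖
  choose m hm using hm
  have hme : ∀ a, ‖x (a, m a) - e a‖ ≤ 2 * η := by
    intro a
    obtain ⟨i, hi⟩ := (hx a).near
    have h1 := norm_sub_le_norm_sub_add_norm_sub (x (a, i)) (c a) (e a)
    have h2 := hec a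
    rw [norm_sub_rev] at h2
    linarith [hm a i]
  have hmc : ∀ a, ‖x (a, m a) - c a‖ ≤ 3 * η := by
    intro a
    have h1 := norm_sub_le_norm_sub_add_norm_sub (x (a, m a)) (e a) (c a)
    linarith [hme a, hec a]
  have hsum : ∀ b j, ∑ i, (sqDist x (b, i) (b, j) - sqDist x (b, i) (b, m b)) =
      n * (‖x (b, j) - e b‖ ^ 2 - ‖x (b, m b) - e b‖ ^ 2) := by
    intro b j
    have := sum_norm_sub_sq_sub (fun i => x (b, i)) (he0 b) (x (b, j)) (x (b, m b))
    simpa [sqDist] using this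
  -- the contribution of a point at radius `r` to a candidate medoid at radius `t` of another ball
  have hgain : ∀ a b, a ≠ b → ∀ i j, ∀ r t, ‖x (a, i) - c a‖ ≤ r → r ≤ 1 →
      ‖x (b, j) - c b‖ ≤ t → t ≤ 1 →
      3 + 6 * η + sqDist x (a, i) (a, m a) - sqDist x (a, i) (b, j) ≤
        3 + 6 * η + (r + 3 * η) ^ 2 - (R - t - r) ^ 2 := by
    intro a b hab i j r t hr hr1 ht ht1
    have h1 : ‖x (a, i) - x (a, m a)‖ ≤ r + 3 * η := by
      have := norm_sub_le_norm_sub_add_norm_sub (x (a, i)) (c a) (x (a, m a))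
      rw [norm_sub_rev (c a)] at this
      linarith [hmc a]
    have h2 : R - t - r ≤ ‖x (a, i) - x (b, j)‖ := by
      have h3 := hc a b hab
      rw [dist_eq_norm] at h3
      have h4 := norm_sub_le_norm_sub_add_norm_sub (c a) (x (a, i)) (c b)
      have h5 := norm_sub_le_norm_sub_add_norm_sub (x (a, i)) (x (b, j)) (c b)
      rw [norm_sub_rev (c a) (x (a, i))] at h4
      linarith
    have h3 : ‖x (a, i) - x (a, m a)‖ ^ 2 ≤ (r + 3 * η) ^ 2 :=
      pow_le_pow_left₀ (norm_nonneg _) h1 2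
    have h4 : (R - t - r) ^ 2 ≤ ‖x (a, i) - x (b, j)‖ ^ 2 :=
      pow_le_pow_left₀ (by linarith) h2 2
    simp only [sqDist]
    linarith
  have hgain_neg : ∀ a b, a ≠ b → ∀ i j, ‖x (b, j) - c b‖ ≤ s →
      3 + 6 * η + sqDist x (a, i) (a, m a) - sqDist x (a, i) (b, j) < 0 := by
    intro a b hab i j hj
    have := hgain a b hab i j 1 s ((hx a).mem_ball i) le_rfl hj hs
    have h2 : (R - s - 1) ^ 2 = (R - 1 - s) ^ 2 := by ring
    linarith
  have h := isUniqueOptimalSolution_ballAssignment (w := sqDist x) (m := m) fun z hz =>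
    eq_ballAssignment_of_cost_le (β := 3 + 6 * η) (by positivity) hn ?_ ?_ ?_ hz
  · exact ⟨_, h.1, h.2, clustersAreBalls_ballAssignment m⟩
  · intro a i j
    have h1 := (hx a).mem_ball i
    have h2 := (hx a).mem_ball j
    have h3 := norm_sub_le_norm_sub_add_norm_sub (x (a, i)) (c a) (x (a, j))
    rw [norm_sub_rev (c a)] at h3
    have h4 := norm_sub_le_norm_sub_add_norm_sub (x (a, i)) (x (a, m a)) (c a)
    have h5 := hmc a
    have h6 : ‖x (a, i) - c a‖ ^ 2 - 6 * η * ‖x (a, i) - c a‖ ≤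
        ‖x (a, i) - x (a, m a)‖ ^ 2 := by
      have := norm_nonneg (x (a, i) - c a)
      have := norm_nonneg (x (a, i) - x (a, m a))
      by_cases h7 : 3 * η ≤ ‖x (a, i) - c a‖
      · nlinarith
      · nlinarith
    have h7 : ‖x (a, i) - x (a, j)‖ ^ 2 ≤ (‖x (a, i) - c a‖ + 1) ^ 2 :=
      pow_le_pow_left₀ (norm_nonneg _) (by linarith) 2
    simp only [sqDist]
    nlinarith
  · intro a b hab i
    have := hgain_neg a b hab i (m b) ((hmc b).trans hηs)
    linarith
  · intro b j hj
    have hlt : ‖x (b, m b) - e b‖ < ‖x (b, j) - e b‖ := by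
      refine lt_of_le_of_ne (hm b j) fun heq => ?_
      apply (hx b).no_tie j (m b) hj
      have := sum_norm_sub_sq_sub (fun i => x (b, i)) (he0 b) (x (b, j)) (x (b, m b))
      simpa [heq] using this
    rw [hsum]
    by_cases hjs : ‖x (b, j) - c b‖ ≤ s
    · rw [Finset.sum_eq_zero]
      · have := pow_lt_pow_left₀ hlt (norm_nonneg _) two_ne_zero
        exact mul_pos hn' (by linarith)
      · intro a ha
        exact Finset.sum_eq_zero fun i _ =>
          max_eq_right (hgain_neg a b (Finset.ne_of_mem_erase ha) i j hjs).le
    · push Not at hjs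
      set G := 3 + 6 * η + (1 + 3 * η) ^ 2 - (R - 2) ^ 2 with hG
      have hball : ∀ a, a ≠ b → ∑ i, max (3 + 6 * η + sqDist x (a, i) (a, m a) -
          sqDist x (a, i) (b, j)) 0 ≤ n * f * G := by
        intro a hab
        calc _ ≤ ∑ i : Fin n, if ρ ≤ ‖x (a, i) - c a‖ then G else 0 := by
              refine Finset.sum_le_sum fun i _ => ?_
              have hr := (hx a).mem_ball i
              have ht := (hx b).mem_ball j
              split_ifs with hi
              · refine max_le ?_ gain_pos
                have := hgain a b hab i j 1 1 hr le_rfl ht le_rfl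
                have h2 : (R - 1 - 1) ^ 2 = (R - 2) ^ 2 := by ring
                linarith
              · refine max_le ?_ le_rfl
                have := hgain a b hab i j ρ 1 (not_le.1 hi).le hρ ht le_rfl
                linarith
          _ = ((Finset.univ.filter fun i => ρ ≤ ‖x (a, i) - c a‖).card : ℝ) * G := by
              rw [← Finset.sum_filter, Finset.sum_const, nsmul_eq_mul]
          _ ≤ n * f * G := mul_le_mul_of_nonneg_right (hx a).far gain_pos
      have hdist : (s - η) ^ 2 ≤ ‖x (b, j) - e b‖ ^ 2 := by
        refine pow_le_pow_left₀ (by linarith) ?_ 2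
        have := norm_sub_le_norm_sub_add_norm_sub (x (b, j)) (e b) (c b)
        linarith [hec b]
      have hmed : ‖x (b, m b) - e b‖ ^ 2 ≤ 4 * η ^ 2 := by
        have := pow_le_pow_left₀ (norm_nonneg _) (hme b) 2
        linarith [show (2 * η) ^ 2 = 4 * η ^ 2 by ring]
      calc _ ≤ ∑ a ∈ Finset.univ.erase b, n * f * G :=
            Finset.sum_le_sum fun a ha => hball a (Finset.ne_of_mem_erase ha)
        _ = n * ((k - 1) * (f * G)) := by
            rw [Finset.sum_const, Finset.card_erase_of_mem (Finset.mem_univ b), Finset.card_univ,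
              Fintype.card_fin, nsmul_eq_mul, Nat.cast_sub hk]
            push_cast
            ring
        _ < n * ((s - η) ^ 2 - 4 * η ^ 2) := mul_lt_mul_of_pos_left gain_lt hn'
        _ ≤ _ := mul_le_mul_of_nonneg_left (by linarith) hn'.le

/-! ### Tail bounds for the sample of one ball -/

/-- Replacing `⟪u, v⟫` by `±‖u‖ * ‖v‖` does not decrease any term of the power series, by convexity of
`x ↦ x ^ j`. -/
theorem cosh_norm_add_add_cosh_norm_sub_le {E : Type*} [NormedAddCommGroup E]
    [InnerProductSpace ℝ E] (u v : E) :
    Real.cosh ‖u + v‖ + Real.cosh ‖u - v‖ ≤ 2 * (Real.cosh ‖u‖ * Real.cosh ‖v‖) := by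
  have h : 2 * (Real.cosh ‖u‖ * Real.cosh ‖v‖) =
      Real.cosh (‖u‖ + ‖v‖) + Real.cosh (‖u‖ - ‖v‖) := by
    rw [Real.cosh_add, Real.cosh_sub]
    ring
  rw [h]
  refine hasSum_le (fun j => ?_) ((Real.hasSum_cosh ‖u + v‖).add (Real.hasSum_cosh ‖u - v‖))
    ((Real.hasSum_cosh (‖u‖ + ‖v‖)).add (Real.hasSum_cosh (‖u‖ - ‖v‖)))
  rw [← add_div, ← add_div]
  refine div_le_div_of_nonneg_right ?_ (by positivity)
  simp only [pow_mul]
  rw [norm_add_sq_real, norm_sub_sq_real, add_sq, sub_sq]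
  set A := ‖u‖ ^ 2 + ‖v‖ ^ 2 with hA
  set B := 2 * inner ℝ u v with hB
  set C := 2 * ‖u‖ * ‖v‖ with hC
  have hBC : |B| ≤ C := by
    rw [hB, hC, abs_mul, abs_two, mul_assoc]
    exact mul_le_mul_of_nonneg_left (abs_real_inner_le_norm u v) two_pos.le
  have hCA : C ≤ A := by
    have := sq_nonneg (‖u‖ - ‖v‖)
    rw [hA, hC]
    linarith [sub_sq ‖u‖ ‖v‖]
  have e1 : ‖u‖ ^ 2 + B + ‖v‖ ^ 2 = A + B := by rw [hA]; ring
  have e2 : ‖u‖ ^ 2 - B + ‖v‖ ^ 2 = A - B := by rw [hA]; ring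
  have e3 : ‖u‖ ^ 2 + C + ‖v‖ ^ 2 = A + C := by rw [hA]; ring
  have e4 : ‖u‖ ^ 2 - C + ‖v‖ ^ 2 = A - C := by rw [hA]; ring
  rw [e1, e2, e3, e4]
  obtain ⟨hB1, hB2⟩ := abs_le.1 hBC
  rcases (abs_nonneg B |>.trans hBC).eq_or_lt with hC0 | hC0
  · have : B = 0 := by rw [← hC0] at hB1 hB2; linarith
    rw [this, ← hC0]
  -- `A ± B` are convex combinations of `A ± C`, with mirrored weights
  have hconv := convexOn_pow (𝕜 := ℝ) j
  have m1 : A + C ∈ Set.Ici (0 : ℝ) := by simp only [Set.mem_Ici]; linarith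
  have m2 : A - C ∈ Set.Ici (0 : ℝ) := by simp only [Set.mem_Ici]; linarith
  have w1 : 0 ≤ (C + B) / (2 * C) := div_nonneg (by linarith) (by linarith)
  have w2 : 0 ≤ (C - B) / (2 * C) := div_nonneg (by linarith) (by linarith)
  have w : (C + B) / (2 * C) + (C - B) / (2 * C) = 1 := by field_simp; ring
  have w' : (C - B) / (2 * C) + (C + B) / (2 * C) = 1 := by field_simp; ring
  have k1 := hconv.2 m1 m2 w1 w2 w
  have k2 := hconv.2 m1 m2 w2 w1 w'
  simp only [smul_eq_mul] at k1 k2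
  have f1 : (C + B) / (2 * C) * (A + C) + (C - B) / (2 * C) * (A - C) = A + B := by
    field_simp; ring
  have f2 : (C - B) / (2 * C) * (A + C) + (C + B) / (2 * C) * (A - C) = A - B := by
    field_simp; ring
  rw [f1] at k1
  rw [f2] at k2
  calc (A + B) ^ j + (A - B) ^ j ≤ _ := add_le_add k1 k2
    _ = ((C + B) / (2 * C) + (C - B) / (2 * C)) * ((A + C) ^ j + (A - C) ^ j) := by ring
    _ = _ := by rw [w, one_mul]

section Tails

variable {d : ℕ} {c : EuclideanSpace ℝ (Fin d)} {μ : Measure (EuclideanSpace ℝ (Fin d))}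

theorem IsBallLaw.ae_norm_le (h : IsBallLaw c μ) : ∀ᵐ x ∂μ, ‖x - c‖ ≤ 1 := by
  have := h.supported
  rw [ae_iff]
  convert this using 2
  ext x
  simp [dist_eq_norm]

/-- Pinelis' dimension-free exponential moment bound for a sum of symmetric random vectors. -/
theorem IsBallLaw.lintegral_cosh_norm_sum_le (h : IsBallLaw c μ) (t : ℝ) (n : ℕ) :
    ∫⁻ x, ENNReal.ofReal (Real.cosh ‖t • ∑ i, (x i - c)‖) ∂Measure.pi (fun _ : Fin n => μ) ≤
      ENNReal.ofReal (Real.cosh t) ^ n := by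
  have := h.isProb
  induction n with
  | zero => simp
  | succ n ih =>
    have hmp := measurePreserving_piFinSuccAbove (fun _ : Fin (n + 1) => μ) 0
    rw [← (hmp.symm _).lintegral_comp (by fun_prop), lintegral_prod_symm _ (by fun_prop)]
    calc _ ≤ ∫⁻ y, ENNReal.ofReal (Real.cosh t) *
          ENNReal.ofReal (Real.cosh ‖t • ∑ i, (y i - c)‖) ∂Measure.pi (fun _ : Fin n => μ) := by
          refine lintegral_mono fun y => ?_
          set s := t • ∑ i, (y i - c) with hs
          have hsum : ∀ z : EuclideanSpace ℝ (Fin d), t • ∑ i, ((MeasurableEquiv.piFinSuccAbove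
              (fun _ : Fin (n + 1) => EuclideanSpace ℝ (Fin d)) 0).symm (z, y) i - c) =
              s + t • (z - c) := by
            intro z
            rw [Fin.sum_univ_succ, smul_add, add_comm, hs]
            rfl
          simp only [hsum]
          -- symmetrize in the new point
          have hflip : ∫⁻ z, ENNReal.ofReal (Real.cosh ‖s + t • (z - c)‖) ∂μ =
              ∫⁻ z, ENNReal.ofReal (Real.cosh ‖s - t • (z - c)‖) ∂μ := by
            conv_lhs => rw [← h.isotropic (LinearIsometryEquiv.neg ℝ)]
            rw [lintegral_map (by fun_prop) (by fun_prop)]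
            simp [sub_eq_add_neg]
          have hae : ∀ᵐ z ∂μ, ENNReal.ofReal (Real.cosh ‖s + t • (z - c)‖) +
              ENNReal.ofReal (Real.cosh ‖s - t • (z - c)‖) ≤
              2 * (ENNReal.ofReal (Real.cosh t) * ENNReal.ofReal (Real.cosh ‖s‖)) := by
            filter_upwards [h.ae_norm_le] with z hz
            have h2 : 2 * (ENNReal.ofReal (Real.cosh t) * ENNReal.ofReal (Real.cosh ‖s‖)) =
                ENNReal.ofReal (2 * (Real.cosh t * Real.cosh ‖s‖)) := by
              rw [ENNReal.ofReal_mul two_pos.le, ENNReal.ofReal_mul (Real.cosh_pos _).le]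
              simp
            rw [← ENNReal.ofReal_add (Real.cosh_pos _).le (Real.cosh_pos _).le, h2]
            refine ENNReal.ofReal_le_ofReal ((cosh_norm_add_add_cosh_norm_sub_le _ _).trans ?_)
            rw [mul_comm (Real.cosh t)]
            have : Real.cosh ‖t • (z - c)‖ ≤ Real.cosh t := by
              rw [Real.cosh_le_cosh, abs_norm, norm_smul, Real.norm_eq_abs]
              exact mul_le_of_le_one_right (abs_nonneg t) hz
            gcongr
          have h2 : 2 * ∫⁻ z, ENNReal.ofReal (Real.cosh ‖s + t • (z - c)‖) ∂μ ≤
              2 * (ENNReal.ofReal (Real.cosh t) * ENNReal.ofReal (Real.cosh ‖s‖)) := by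
            calc _ = ∫⁻ z, (ENNReal.ofReal (Real.cosh ‖s + t • (z - c)‖) +
                ENNReal.ofReal (Real.cosh ‖s - t • (z - c)‖)) ∂μ := by
                  rw [lintegral_add_left (by fun_prop), ← hflip, two_mul]
              _ ≤ ∫⁻ _, _ ∂μ := lintegral_mono_ae hae
              _ = _ := by simp
          exact (ENNReal.mul_le_mul_iff_right two_ne_zero ENNReal.ofNat_ne_top).1 h2
      _ = ENNReal.ofReal (Real.cosh t) * ∫⁻ y,
          ENNReal.ofReal (Real.cosh ‖t • ∑ i, (y i - c)‖) ∂Measure.pi (fun _ : Fin n => μ) :=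
          lintegral_const_mul _ (by fun_prop)
      _ ≤ _ := by
          rw [pow_succ']
          gcongr

/-- Markov's inequality for `cosh (η * ‖S‖)`, where `S` is the centered sum; `η` is the optimal
factor. -/
theorem IsBallLaw.measure_norm_sum_gt_le (h : IsBallLaw c μ) {η : ℝ} (hη : 0 ≤ η) (n : ℕ) :
    Measure.pi (fun _ : Fin n => μ) {x | ¬ ‖∑ i, (x i - c)‖ ≤ n * η} ≤
      ENNReal.ofReal (2 * Real.exp (-(n * η ^ 2 / 2))) := by
  set K := ENNReal.ofReal (Real.cosh (n * η ^ 2)) with hK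
  have hK0 : K ≠ 0 := by simp [hK, Real.cosh_pos]
  calc _ ≤ Measure.pi (fun _ : Fin n => μ)
        {x | K ≤ ENNReal.ofReal (Real.cosh ‖η • ∑ i, (x i - c)‖)} := by
        refine measure_mono fun x hx => ENNReal.ofReal_le_ofReal ?_
        simp only [Set.mem_ofPred_eq, not_le] at hx
        rw [Real.cosh_le_cosh, abs_norm, norm_smul, Real.norm_of_nonneg hη,
          abs_of_nonneg (by positivity)]
        nlinarith
    _ ≤ (∫⁻ x, ENNReal.ofReal (Real.cosh ‖η • ∑ i, (x i - c)‖)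
          ∂Measure.pi (fun _ : Fin n => μ)) / K :=
        meas_ge_le_lintegral_div (Measurable.aemeasurable (by fun_prop)) hK0 ENNReal.ofReal_ne_top
    _ ≤ ENNReal.ofReal (Real.cosh η) ^ n / K := by
        gcongr
        exact h.lintegral_cosh_norm_sum_le η n
    _ ≤ _ := by
        rw [hK, ← ENNReal.ofReal_pow (Real.cosh_pos _).le,
          ← ENNReal.ofReal_div_of_pos (Real.cosh_pos _)]
        refine ENNReal.ofReal_le_ofReal ?_
        rw [div_le_iff₀ (Real.cosh_pos _)]
        have h1 : Real.cosh η ^ n ≤ Real.exp (n * η ^ 2 / 2) := by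
          calc _ ≤ Real.exp (η ^ 2 / 2) ^ n :=
                pow_le_pow_left₀ (Real.cosh_pos _).le (Real.cosh_le_exp_half_sq η) n
            _ = _ := by rw [← Real.exp_nat_mul]; ring_nf
        have h2 : Real.exp (n * η ^ 2) / 2 ≤ Real.cosh (n * η ^ 2) := by
          rw [Real.cosh_eq]
          linarith [Real.exp_pos (-(n * η ^ 2))]
        have h3 : Real.exp (n * η ^ 2 / 2) =
            2 * Real.exp (-(n * η ^ 2 / 2)) * (Real.exp (n * η ^ 2) / 2) := by
          have e1 : n * η ^ 2 = n * η ^ 2 / 2 + n * η ^ 2 / 2 := by ring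
          rw [Real.exp_neg, e1, Real.exp_add, ← e1]
          have := Real.exp_pos (n * η ^ 2 / 2)
          field_simp
        rw [h3] at h1
        exact h1.trans (mul_le_mul_of_nonneg_left h2 (by positivity))

theorem IsBallLaw.measure_forall_far_le (h : IsBallLaw c μ) {η : ℝ} (hη : 0 ≤ η) (hη1 : η ≤ 1)
    (n : ℕ) :
    Measure.pi (fun _ : Fin n => μ) {x | ¬ ∃ i, ‖x i - c‖ ≤ η} ≤
      ENNReal.ofReal (Real.exp (-(n * η ^ 2 / 2))) := by
  have := h.isProb
  calc _ ≤ Measure.pi (fun _ : Fin n => μ) (Set.univ.pi fun _ => {x | η ≤ ‖x - c‖}) := by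
        refine measure_mono fun x hx => ?_
        simp only [Set.mem_ofPred_eq, not_exists, not_le] at hx
        exact fun i _ => (hx i).le
    _ = ENNReal.ofReal (μ.real {x | η ≤ ‖x - c‖}) ^ n := by
        rw [Measure.pi_pi]
        simp
    _ ≤ ENNReal.ofReal (1 - η ^ 2) ^ n := by
        gcongr
        exact h.tail η hη hη1
    _ ≤ ENNReal.ofReal (Real.exp (-(η ^ 2 / 2))) ^ n := by
        gcongr
        have := Real.add_one_le_exp (-(η ^ 2 / 2))
        nlinarith [sq_nonneg η]
    _ = _ := by
        rw [← ENNReal.ofReal_pow (Real.exp_pos _).le, ← Real.exp_nat_mul]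
        ring_nf

theorem IsBallLaw.measure_many_far_le (h : IsBallLaw c μ) {η ρ : ℝ} (hη : 0 ≤ η) (hρ : 0 ≤ ρ)
    (hρ1 : ρ ≤ 1) {n : ℕ} (hn : 0 < n) :
    Measure.pi (fun _ : Fin n => μ) {x | ¬ ((Finset.univ.filter fun i => ρ ≤ ‖x i - c‖).card : ℝ) ≤
        n * (1 - ρ ^ 2 + η / 2)} ≤ ENNReal.ofReal (Real.exp (-(n * η ^ 2 / 2))) := by
  have := h.isProb
  set I : EuclideanSpace ℝ (Fin d) → ℝ := Set.indicator {x | ρ ≤ ‖x - c‖} 1 with hI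
  have hS : MeasurableSet {x : EuclideanSpace ℝ (Fin d) | ρ ≤ ‖x - c‖} :=
    measurableSet_le (by fun_prop) (by fun_prop)
  have hIm : Measurable I := measurable_one.indicator hS
  set p := μ.real {x | ρ ≤ ‖x - c‖} with hp
  have hint : ∫ x, I x ∂μ = p := integral_indicator_one hS
  have hp1 : p ≤ 1 - ρ ^ 2 := h.tail ρ hρ hρ1
  have hsub : ProbabilityTheory.HasSubgaussianMGF (fun x => I x - p) (1 / 4) μ := by
    have := ProbabilityTheory.hasSubgaussianMGF_of_mem_Icc (μ := μ) (X := I) (a := 0) (b := 1)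
      hIm.aemeasurable (ae_of_all _ fun x => by
        by_cases hx : ρ ≤ ‖x - c‖ <;> simp [hI, hx])
    rw [hint] at this
    convert this using 1
    norm_num
  have hsubi : ∀ i ∈ (Finset.univ : Finset (Fin n)), ProbabilityTheory.HasSubgaussianMGF
      (fun x : Fin n → EuclideanSpace ℝ (Fin d) => I (x i) - p) (1 / 4)
      (Measure.pi (fun _ : Fin n => μ)) := by
    intro i _
    have hmp := measurePreserving_eval (fun _ : Fin n => μ) i
    rw [← hmp.map_eq] at hsub
    exact hsub.of_map hmp.measurable.aemeasurable
  have hind : ProbabilityTheory.iIndepFun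
      (fun i (x : Fin n → EuclideanSpace ℝ (Fin d)) => I (x i) - p)
      (Measure.pi (fun _ : Fin n => μ)) :=
    ProbabilityTheory.iIndepFun_pi (X := fun _ x => I x - p)
      fun _ => (hIm.sub_const p).aemeasurable
  have hoeff := ProbabilityTheory.HasSubgaussianMGF.measure_sum_ge_le_of_iIndepFun hind hsubi
    (ε := n * (η / 2)) (by positivity)
  have hexp : -(n * (η / 2)) ^ 2 / (2 * ((∑ _i : Fin n, (1 / 4) : NNReal) : ℝ)) =
      -(n * η ^ 2 / 2) := by
    have : (n : ℝ) ≠ 0 := by positivity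
    simp
    field_simp
    norm_num
  rw [hexp] at hoeff
  rw [← ofReal_measureReal]
  refine ENNReal.ofReal_le_ofReal (le_trans ?_ hoeff)
  refine measureReal_mono fun x hx => ?_
  simp only [Set.mem_ofPred_eq, not_le] at hx ⊢
  rw [Finset.sum_sub_distrib]
  have hcard : ∑ i, I (x i) = ((Finset.univ.filter fun i => ρ ≤ ‖x i - c‖).card : ℝ) := by
    rw [Finset.card_filter]
    push_cast
    refine Finset.sum_congr rfl fun i _ => ?_
    simp [hI, Set.indicator_apply]
  rw [hcard]
  simp only [Finset.sum_const, Finset.card_univ, Fintype.card_fin, nsmul_eq_mul]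
  nlinarith [(Nat.cast_nonneg n : (0 : ℝ) ≤ n)]

end Tails

/-! ### Hyperplanes are null and ties do not occur -/

/-- A sequence of vectors on a sphere such that every nonzero vector lies on finitely many of the
parallel affine hyperplanes they define: an inverse stereographic image of the moment curve, on
which affine functions are nonzero polynomials up to a common denominator. -/
theorem exists_norm_eq_finite_inner_eq {d : ℕ} (hd : 2 ≤ d) {r : ℝ} (hr : 0 < r) (t : ℝ) :
    ∃ u : ℕ → EuclideanSpace ℝ (Fin d), (∀ j, ‖u j‖ = r) ∧
      ∀ y : EuclideanSpace ℝ (Fin d), y ≠ 0 → {j | inner ℝ y (u j) = t}.Finite := by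
  obtain ⟨m, rfl⟩ := Nat.exists_eq_add_of_le' hd
  set S : ℝ → ℝ := fun q => ∑ i : Fin (m + 1), (q ^ ((i : ℕ) + 1)) ^ 2 with hS
  have hSpos : ∀ q, 0 < S q + 1 := fun q => by
    have : 0 ≤ S q := Finset.sum_nonneg fun i _ => sq_nonneg _
    linarith
  set v : ℝ → EuclideanSpace ℝ (Fin (m + 2)) := fun q =>
    WithLp.toLp 2 (Fin.cons (S q - 1) fun i : Fin (m + 1) => 2 * q ^ ((i : ℕ) + 1)) with hv
  have hvn : ∀ q, ‖v q‖ = S q + 1 := by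
    intro q
    rw [EuclideanSpace.norm_eq, Real.sqrt_eq_iff_mul_self_eq_of_pos (hSpos q), Fin.sum_univ_succ]
    simp only [hv, Fin.cons_zero, Fin.cons_succ, Real.norm_eq_abs, sq_abs, mul_pow]
    rw [← Finset.mul_sum]
    change _ = (S q - 1) ^ 2 + 2 ^ 2 * S q
    ring
  refine ⟨fun j => (r / (S j + 1)) • v j, fun j => ?_, fun y hy => ?_⟩
  · rw [norm_smul, hvn, Real.norm_of_nonneg (div_pos hr (hSpos j)).le,
      div_mul_cancel₀ _ (hSpos j).ne']
  set τ := t / r with hτ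
  set P : Polynomial ℝ := Polynomial.C (y 0 - τ) * (∑ i : Fin (m + 1),
    (Polynomial.X ^ ((i : ℕ) + 1)) ^ 2) + ∑ i : Fin (m + 1),
      Polynomial.C (2 * y i.succ) * Polynomial.X ^ ((i : ℕ) + 1) - Polynomial.C (y 0 + τ) with hP
  have hP0 : P ≠ 0 := by
    intro h0
    have hc : ∀ l, P.coeff l = 0 := fun l => by rw [h0, Polynomial.coeff_zero]
    have hc' : ∀ l, P.coeff l = (y 0 - τ) * (∑ i : Fin (m + 1),
        if l = ((i : ℕ) + 1) * 2 then 1 else 0) +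
        (∑ i : Fin (m + 1), if l = (i : ℕ) + 1 then 2 * y i.succ else 0) -
        if l = 0 then y 0 + τ else 0 := by
      intro l
      rw [hP]
      simp only [← pow_mul, Polynomial.coeff_sub, Polynomial.coeff_add, Polynomial.coeff_C_mul,
        Polynomial.finsetSum_coeff, Polynomial.coeff_X_pow, Polynomial.coeff_C, mul_ite, mul_one,
        mul_zero]
    -- the constant and the leading coefficient give `y 0 = τ = 0`, as `(m + 1) * 2 > m + 1`
    have h1 := hc 0
    rw [hc'] at h1
    simp only [Nat.zero_eq_mul, Nat.succ_ne_zero, OfNat.ofNat_ne_zero, or_self, if_false,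
      Finset.sum_const_zero, mul_zero, if_true, (Nat.succ_ne_zero _).symm] at h1
    have h2 := hc ((m + 1) * 2)
    rw [hc', Finset.sum_eq_single (Fin.last m), Finset.sum_eq_zero] at h2
    · simp at h2
      have h3 : y 0 = 0 := by linarith
      have h4 : τ = 0 := by linarith
      apply hy
      ext i
      refine Fin.cases h3 (fun i => ?_) i
      have h5 := hc ((i : ℕ) + 1)
      rw [hc', h3, h4, Finset.sum_eq_single (s := Finset.univ) (f := fun i_1 : Fin (m + 1) =>
        if (i : ℕ) + 1 = (i_1 : ℕ) + 1 then 2 * y i_1.succ else 0) i] at h5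
      · simpa using h5
      · intro b _ hb
        rw [if_neg]
        intro h
        exact hb (Fin.ext (by omega))
      · simp
    · intro i _
      rw [if_neg]
      have := i.2
      omega
    · intro i _ hi
      rw [if_neg]
      intro h
      exact hi (Fin.ext (by simp; omega))
    · simp
  refine ((P.rootSet_finite ℝ).preimage (Nat.cast_injective.injOn)).subset fun j hj => ?_
  simp only [Set.mem_preimage, Polynomial.mem_rootSet, ne_eq, hP0, not_false_eq_true, true_and,
    Polynomial.coe_aeval_eq_eval]
  have h1 : inner ℝ y (v j) = τ * (S j + 1) := by
    have hj' : r / (S j + 1) * inner ℝ y (v j) = t := by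
      simpa [inner_smul_right] using hj
    have := (hSpos j).ne'
    rw [hτ, ← hj']
    field_simp
  have h2 : inner ℝ y (v j) = y 0 * (S j - 1) +
      ∑ i : Fin (m + 1), 2 * y i.succ * (j : ℝ) ^ ((i : ℕ) + 1) := by
    rw [PiLp.inner_apply, Fin.sum_univ_succ]
    simp only [hv, Fin.cons_zero, Fin.cons_succ, RCLike.inner_apply, conj_trivial]
    congr 1
    · ring
    · exact Finset.sum_congr rfl fun i _ => by ring
  rw [hP]
  simp only [Polynomial.eval_sub, Polynomial.eval_add, Polynomial.eval_mul, Polynomial.eval_C,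
    Polynomial.eval_finsetSum, Polynomial.eval_pow, Polynomial.eval_X]
  change (y 0 - τ) * S j + _ - _ = 0
  linarith

section Ties

variable {d : ℕ} {c : EuclideanSpace ℝ (Fin d)} {μ : Measure (EuclideanSpace ℝ (Fin d))}

theorem measurableSet_inner_sub_eq (c v : EuclideanSpace ℝ (Fin d)) (t : ℝ) :
    MeasurableSet {x | inner ℝ (x - c) v = t} :=
  measurableSet_eq_fun (by fun_prop) (by fun_prop)

/-- The reflection that maps `u` to `v` preserves the law. -/
theorem IsBallLaw.measure_hyperplane_eq (h : IsBallLaw c μ) {u v : EuclideanSpace ℝ (Fin d)}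
    (huv : ‖u‖ = ‖v‖) (t : ℝ) :
    μ {x | inner ℝ (x - c) u = t} = μ {x | inner ℝ (x - c) v = t} := by
  set U := (ℝ ∙ (u - v))ᗮ.reflection with hU
  conv_rhs => rw [← h.isotropic U]
  rw [Measure.map_apply (by fun_prop) (measurableSet_inner_sub_eq c v t)]
  congr 1
  ext x
  simp only [Set.mem_ofPred_eq, Set.mem_preimage, add_sub_cancel_left]
  rw [← Submodule.reflection_sub huv, ← hU, LinearIsometryEquiv.inner_map_map]

/-- All hyperplanes at the same distance from the center have the same measure, and there are
infinitely many of them such that every point but the center lies on only finitely many. Since the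
law is finite and has no atom at the center, that measure is zero. -/
theorem IsBallLaw.measure_hyperplane (h : IsBallLaw c μ) (hd : 2 ≤ d)
    {v : EuclideanSpace ℝ (Fin d)} (hv : v ≠ 0) (t : ℝ) :
    μ {x | inner ℝ (x - c) v = t} = 0 := by
  have := h.isProb
  obtain ⟨u, hu, hfin⟩ := exists_norm_eq_finite_inner_eq hd (norm_pos_iff.2 hv) t
  set A : ℕ → Set (EuclideanSpace ℝ (Fin d)) := fun j => {x | inner ℝ (x - c) (u j) = t} with hA
  set B : ℕ → Set (EuclideanSpace ℝ (Fin d)) := fun N => ⋃ j ≥ N, A j with hB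
  have hBm : ∀ N, MeasurableSet (B N) := fun N =>
    MeasurableSet.iUnion fun j => MeasurableSet.iUnion fun _ => measurableSet_inner_sub_eq c _ t
  have hBanti : Antitone B := fun N M hNM =>
    Set.biUnion_subset_biUnion_left fun j hj => le_trans hNM hj
  have hlim := tendsto_measure_iInter_atTop (μ := μ) (fun N => (hBm N).nullMeasurableSet) hBanti
    ⟨0, measure_ne_top _ _⟩
  have hnull : μ (⋂ N, B N) = 0 := by
    refine measure_mono_null (fun x hx => ?_) h.center_null
    by_contra hxc
    obtain ⟨N, hN⟩ := (hfin (x - c) (sub_ne_zero.2 hxc)).bddAbove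
    have := Set.mem_iInter.1 hx (N + 1)
    simp only [hB, Set.mem_iUnion] at this
    obtain ⟨j, hj, hxj⟩ := this
    have := hN hxj
    omega
  rw [hnull] at hlim
  refine le_antisymm (ge_of_tendsto' hlim fun N => ?_) zero_le
  rw [← h.measure_hyperplane_eq (hu N) t]
  exact measure_mono (Set.subset_biUnion_of_mem (u := A) (le_refl N))

theorem pi_null_of_forall_update {n : ℕ} {E : Type*} [MeasurableSpace E] {μ : Measure E}
    [IsProbabilityMeasure μ] {s : Set (Fin n → E)} (hs : MeasurableSet s) (l : Fin n)
    (h : ∀ x, μ {y | Function.update x l y ∈ s} = 0) : Measure.pi (fun _ : Fin n => μ) s = 0 := by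
  obtain ⟨m, rfl⟩ := Nat.exists_eq_succ_of_ne_zero l.pos.ne'
  have hmp := (measurePreserving_piFinSuccAbove (fun _ : Fin (m + 1) => μ) l).symm
  rw [← hmp.measure_preimage hs.nullMeasurableSet, Measure.prod_apply_symm (hmp.measurable hs),
    lintegral_eq_zero_iff (measurable_measure_prodMk_right (hmp.measurable hs))]
  refine Filter.Eventually.of_forall fun y => ?_
  obtain ⟨e⟩ : Nonempty E := μ.nonempty_of_neZero
  rw [Pi.zero_apply, ← h (l.insertNth e y)]
  refine congrArg μ (Set.ext fun z => ?_)
  rw [Set.mem_ofPred_eq, Fin.update_insertNth]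
  rfl

theorem IsBallLaw.measure_eq_null (h : IsBallLaw c μ) (hd : 2 ≤ d)
    (y : EuclideanSpace ℝ (Fin d)) : μ {y} = 0 := by
  have hv : EuclideanSpace.single (⟨0, by omega⟩ : Fin d) (1 : ℝ) ≠ 0 := by simp
  refine measure_mono_null (fun x hx => ?_) (h.measure_hyperplane hd hv
    (inner ℝ (y - c) (EuclideanSpace.single (⟨0, by omega⟩ : Fin d) (1 : ℝ))))
  rw [Set.mem_singleton_iff.1 hx]
  rfl

/-- Resampling a third point of the ball shows that two points almost surely do not tie: given the
others, a tie confines the third point to a hyperplane. -/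
theorem IsBallLaw.measure_tie (h : IsBallLaw c μ) (hd : 2 ≤ d) {n : ℕ} (hn : 3 ≤ n) {i j : Fin n}
    (hij : i ≠ j) : Measure.pi (fun _ : Fin n => μ)
      {x | ∑ l, (‖x l - x i‖ ^ 2 - ‖x l - x j‖ ^ 2) = 0} = 0 := by
  have := h.isProb
  have heq : Measure.pi (fun _ : Fin n => μ) {x | x i = x j} = 0 := by
    refine pi_null_of_forall_update (measurableSet_eq_fun (by fun_prop) (by fun_prop)) i
      fun x => ?_
    simpa [Function.update_of_ne hij.symm] using h.measure_eq_null hd (x j)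
  obtain ⟨l, hl⟩ : ∃ l, l ∉ ({i, j} : Finset (Fin n)) := by
    by_contra! hcon
    have h1 := Finset.card_le_card fun l (_ : l ∈ (Finset.univ : Finset (Fin n))) => hcon l
    have h2 := Finset.card_le_two (a := i) (b := j)
    rw [Finset.card_univ, Fintype.card_fin] at h1
    omega
  simp only [Finset.mem_insert, Finset.mem_singleton, not_or] at hl
  have hne : Measure.pi (fun _ : Fin n => μ)
      ({x | ∑ l, (‖x l - x i‖ ^ 2 - ‖x l - x j‖ ^ 2) = 0} \ {x | x i = x j}) = 0 := by
    refine pi_null_of_forall_update (MeasurableSet.diff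
      (measurableSet_eq_fun (by fun_prop) (by fun_prop))
      (measurableSet_eq_fun (by fun_prop) (by fun_prop))) l fun x => ?_
    by_cases hx : x i = x j
    · simp [Function.update_of_ne (Ne.symm hl.1), Function.update_of_ne (Ne.symm hl.2), hx]
    set K := ∑ l' ∈ Finset.univ.erase l, (‖x l' - x i‖ ^ 2 - ‖x l' - x j‖ ^ 2) with hK
    refine measure_mono_null (fun y hy => ?_) (h.measure_hyperplane hd
      (sub_ne_zero.2 (Ne.symm hx)) (-(K + ‖x i - c‖ ^ 2 - ‖x j - c‖ ^ 2) / 2))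
    have hy := hy.1
    simp only [Set.mem_ofPred_eq, Function.update_of_ne (Ne.symm hl.1),
      Function.update_of_ne (Ne.symm hl.2)] at hy
    rw [← Finset.add_sum_erase _ _ (Finset.mem_univ l), Function.update_self,
      Finset.sum_congr rfl (g := fun l' => ‖x l' - x i‖ ^ 2 - ‖x l' - x j‖ ^ 2)] at hy
    · rw [← hK] at hy
      have e1 : y - x i = (y - c) - (x i - c) := by abel
      have e2 : y - x j = (y - c) - (x j - c) := by abel
      have e3 : inner ℝ (y - c) (x j - x i) =
          inner ℝ (y - c) (x j - c) - inner ℝ (y - c) (x i - c) := by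
        rw [← inner_sub_right, sub_sub_sub_cancel_right]
      rw [e1, e2, norm_sub_sq_real (y - c) (x i - c), norm_sub_sq_real (y - c) (x j - c)] at hy
      rw [Set.mem_ofPred_eq, e3]
      linarith
    · intro l' hl'
      rw [Function.update_of_ne (Finset.ne_of_mem_erase hl')]
  refine measure_mono_null (fun x hx => ?_) (measure_union_null hne heq)
  by_cases hxx : x i = x j
  · exact Or.inr hxx
  · exact Or.inl ⟨hx, hxx⟩

end Ties

/-! ### The probability of recovery -/

theorem IsBallLaw.measure_not_isWellSpread_le {d : ℕ} {c : EuclideanSpace ℝ (Fin d)}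
    {μ : Measure (EuclideanSpace ℝ (Fin d))} (h : IsBallLaw c μ) (hd : 2 ≤ d) {η ρ : ℝ}
    (hη : 0 ≤ η) (hη1 : η ≤ 1) (hρ : 0 ≤ ρ) (hρ1 : ρ ≤ 1) {n : ℕ} (hn : 3 ≤ n) :
    Measure.pi (fun _ : Fin n => μ) {x | ¬ IsWellSpread η ρ (1 - ρ ^ 2 + η / 2) c x} ≤
      ENNReal.ofReal (4 * Real.exp (-(n * η ^ 2 / 2))) := by
  have := h.isProb
  set P := Measure.pi (fun _ : Fin n => μ) with hP
  set B₀ : Set (Fin n → EuclideanSpace ℝ (Fin d)) := {x | ¬ ∀ i, ‖x i - c‖ ≤ 1}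
  set B₁ : Set (Fin n → EuclideanSpace ℝ (Fin d)) := {x | ¬ ‖∑ i, (x i - c)‖ ≤ n * η}
  set B₂ : Set (Fin n → EuclideanSpace ℝ (Fin d)) := {x | ¬ ∃ i, ‖x i - c‖ ≤ η}
  set B₃ : Set (Fin n → EuclideanSpace ℝ (Fin d)) :=
    {x | ¬ ((Finset.univ.filter fun i => ρ ≤ ‖x i - c‖).card : ℝ) ≤ n * (1 - ρ ^ 2 + η / 2)}
  set B₄ : Set (Fin n → EuclideanSpace ℝ (Fin d)) :=
    {x | ¬ ∀ i j, i ≠ j → ∑ l, (‖x l - x i‖ ^ 2 - ‖x l - x j‖ ^ 2) ≠ 0}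
  have h₀ : P B₀ = 0 := by
    rw [← ae_iff, ae_all_iff]
    exact fun i => (measurePreserving_eval (fun _ : Fin n => μ) i).quasiMeasurePreserving.ae
      h.ae_norm_le
  have h₄ : P B₄ = 0 := by
    rw [← ae_iff]
    simp only [ae_all_iff]
    intro i j hij
    rw [ae_iff]
    simpa using h.measure_tie hd hn hij
  calc P {x | ¬ IsWellSpread η ρ (1 - ρ ^ 2 + η / 2) c x} ≤ P (B₁ ∪ B₂ ∪ B₃ ∪ (B₀ ∪ B₄)) := by
        refine measure_mono fun x hx => ?_
        by_contra hcon
        simp only [Set.mem_union, not_or] at hcon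
        obtain ⟨⟨⟨h1, h2⟩, h3⟩, h0, h4⟩ := hcon
        exact hx ⟨not_not.1 h0, not_not.1 h1, not_not.1 h2, not_not.1 h3, not_not.1 h4⟩
    _ ≤ P (B₁ ∪ B₂ ∪ B₃) + P (B₀ ∪ B₄) := measure_union_le _ _
    _ = P (B₁ ∪ B₂ ∪ B₃) := by rw [measure_union_null h₀ h₄, add_zero]
    _ ≤ P B₁ + P B₂ + P B₃ :=
        (measure_union_le _ _).trans (add_le_add_left (measure_union_le _ _) _)
    _ ≤ ENNReal.ofReal (2 * Real.exp (-(n * η ^ 2 / 2))) +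
        ENNReal.ofReal (Real.exp (-(n * η ^ 2 / 2))) +
        ENNReal.ofReal (Real.exp (-(n * η ^ 2 / 2))) :=
        add_le_add (add_le_add (h.measure_norm_sum_gt_le hη n)
          (h.measure_forall_far_le hη hη1 n)) (h.measure_many_far_le hη hρ hρ1 (by omega))
    _ = _ := by
        rw [← ENNReal.ofReal_add (by positivity) (by positivity),
          ← ENNReal.ofReal_add (by positivity) (by positivity)]
        ring_nf

theorem measurePreserving_pi_comp {ι κ E : Type*} [Fintype ι] [Fintype κ] [MeasurableSpace E]
    (μ : ι → Measure E) [∀ i, IsProbabilityMeasure (μ i)] {g : κ → ι}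
    (hg : Function.Injective g) :
    MeasurePreserving (fun x : ι → E => fun j => x (g j)) (Measure.pi μ)
      (Measure.pi fun j => μ (g j)) := by
  have hind := (ProbabilityTheory.iIndepFun_pi (μ := μ) (X := fun _ x => x)
    fun _ => aemeasurable_id).precomp hg
  refine ⟨by fun_prop, ?_⟩
  rw [hind.map_fun_eq_pi_map fun j => (measurable_pi_apply _).aemeasurable]
  congr 1
  ext1 j
  exact (measurePreserving_eval μ (g j)).map_eq

/-- The numerical conditions under which the dual certificate succeeds with the required
probability. Each of the `k` balls fails with probability at most `4 * exp (-(n * η ^ 2 / 2))`, so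
`hexp` is what keeps the total below `4 * k / n`. -/
theorem recoversBalls_of_bounds {d k n : ℕ} (hd : 2 ≤ d) (hk : 1 ≤ k) (hn : 3 ≤ n)
    {R η ρ s : ℝ} (hη : 0 < η) (hηs : 3 * η ≤ s) (hρ0 : 0 ≤ ρ) (hρ : ρ ≤ 1) (hR : 2 < R)
    (hs : s ≤ 1)
    (gain_neg : 3 + 6 * η + (1 + 3 * η) ^ 2 < (R - 1 - s) ^ 2)
    (gain_nonpos : 3 + 6 * η + (ρ + 3 * η) ^ 2 ≤ (R - 1 - ρ) ^ 2)
    (gain_pos : 0 ≤ 3 + 6 * η + (1 + 3 * η) ^ 2 - (R - 2) ^ 2)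
    (gain_lt : (k - 1) * ((1 - ρ ^ 2 + η / 2) *
      (3 + 6 * η + (1 + 3 * η) ^ 2 - (R - 2) ^ 2)) < (s - η) ^ 2 - 4 * η ^ 2)
    (hexp : n * Real.exp (-(n * η ^ 2 / 2)) < 1) :
    RecoversBalls d k n R := by
  intro c μ hc hμ
  have := fun a => (hμ a).isProb
  set P := Measure.pi (fun p : Fin k × Fin n => μ p.1) with hP
  set G := {x : Fin k × Fin n → EuclideanSpace ℝ (Fin d) |
    ∃ z : Fin k × Fin n → Fin k × Fin n → ℝ,
      IsUniqueOptimalSolution (sqDist x) (kMedFeasible (Fin k × Fin n) k) z ∧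
      IsUniqueOptimalSolution (sqDist x) (linKMedFeasible (Fin k × Fin n) k) z ∧
      ClustersAreBalls z} with hG
  set B : Fin k → Set (Fin k × Fin n → EuclideanSpace ℝ (Fin d)) := fun a =>
    {x | ¬ IsWellSpread η ρ (1 - ρ ^ 2 + η / 2) (c a) fun i => x (a, i)} with hB
  have hBle : ∀ a, P.real (B a) ≤ 4 * Real.exp (-(n * η ^ 2 / 2)) := by
    intro a
    have hmp := measurePreserving_pi_comp (fun p : Fin k × Fin n => μ p.1)
      (Prod.mk_right_injective a : Function.Injective fun i : Fin n => (a, i))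
    refine ENNReal.toReal_le_of_le_ofReal (by positivity) ?_
    exact (hmp.measure_preimage_le _).trans
      ((hμ a).measure_not_isWellSpread_le hd hη.le (by linarith) hρ0 hρ hn)
  have hcover : G ∪ ⋃ a, B a = Set.univ := by
    refine Set.eq_univ_of_forall fun x => ?_
    by_cases hx : ∀ a, IsWellSpread η ρ (1 - ρ ^ 2 + η / 2) (c a) fun i => x (a, i)
    · exact Or.inl (recovery_of_isWellSpread hk hη hηs hρ hR hs gain_neg gain_nonpos
        gain_pos gain_lt hc hx)
    · obtain ⟨a, ha⟩ := not_forall.1 hx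
      exact Or.inr (Set.mem_iUnion.2 ⟨a, ha⟩)
  have h1 : (1 : ℝ) ≤ P.real G + P.real (⋃ a, B a) := by
    calc (1 : ℝ) = P.real (G ∪ ⋃ a, B a) := by rw [hcover, probReal_univ]
      _ ≤ _ := measureReal_union_le _ _
  have h2 : P.real (⋃ a, B a) ≤ k * (4 * Real.exp (-(n * η ^ 2 / 2))) := by
    calc _ ≤ ∑ a, P.real (B a) := measureReal_iUnion_fintype_le B
      _ ≤ ∑ _a : Fin k, 4 * Real.exp (-(n * η ^ 2 / 2)) := Finset.sum_le_sum fun a _ => hBle a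
      _ = _ := by simp
  have hn0 : (0 : ℝ) < n := by exact_mod_cast (by omega : 0 < n)
  have hk0 : (0 : ℝ) < k := by exact_mod_cast hk
  have h3 : k * (4 * Real.exp (-(n * η ^ 2 / 2))) < 4 * k / n := by
    rw [lt_div_iff₀ hn0]
    calc _ = 4 * k * (n * Real.exp (-(n * η ^ 2 / 2))) := by ring
      _ < 4 * k * 1 := mul_lt_mul_of_pos_left hexp (by positivity)
      _ = _ := mul_one _
  linarith

theorem RecoversBalls.mono {d k n : ℕ} {R R' : ℝ} (h : RecoversBalls d k n R) (hR : R ≤ R') :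
    RecoversBalls d k n R' := fun c μ hc => h c μ fun a b hab => hR.trans (hc a b hab)

/-- `x * exp (-(a * x))` is decreasing from `1 / a` on, so the tail estimate only has to be checked
at the smallest sample size. -/
theorem mul_exp_neg_le_of_le {a x y : ℝ} (hx : 0 < x) (hax : 1 ≤ a * x) (hxy : x ≤ y) :
    y * Real.exp (-(a * y)) ≤ x * Real.exp (-(a * x)) := by
  have h1 : y / x ≤ Real.exp (a * (y - x)) := by
    refine le_trans ?_ (Real.add_one_le_exp _)
    rw [div_le_iff₀ hx]
    nlinarith [mul_nonneg (sub_nonneg.2 hax) (sub_nonneg.2 hxy)]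
  rw [div_le_iff₀ hx] at h1
  have h2 : Real.exp (-(a * x)) = Real.exp (a * (y - x)) * Real.exp (-(a * y)) := by
    rw [← Real.exp_add]
    ring_nf
  rw [h2]
  nlinarith [Real.exp_pos (-(a * y))]

/-- Here `m` is an integer lower bound for the exponent at the smallest sample size `N`. -/
theorem mul_exp_neg_lt_one {n : ℕ} {η : ℝ} {N m : ℕ} (hN : 0 < N) (hnN : N ≤ n) (hm : 1 ≤ m)
    (hm' : (m : ℝ) ≤ N * η ^ 2 / 2) (hNm : (N : ℝ) < 2.7 ^ m) :
    n * Real.exp (-(n * η ^ 2 / 2)) < 1 := by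
  have hN' : (0 : ℝ) < N := by exact_mod_cast hN
  have hm1 : (1 : ℝ) ≤ m := by exact_mod_cast hm
  have h1 := mul_exp_neg_le_of_le (a := η ^ 2 / 2) (x := N) (y := n) hN' (by linarith)
    (by exact_mod_cast hnN)
  have h2 : (2.7 : ℝ) ^ m ≤ Real.exp (η ^ 2 / 2 * N) := by
    calc (2.7 : ℝ) ^ m ≤ Real.exp 1 ^ m :=
          pow_le_pow_left₀ (by norm_num) (by linarith [Real.exp_one_gt_d9]) m
      _ = Real.exp m := by rw [← Real.exp_nat_mul, mul_one]
      _ ≤ _ := Real.exp_le_exp.2 (by linarith)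
  calc n * Real.exp (-(n * η ^ 2 / 2)) = n * Real.exp (-(η ^ 2 / 2 * n)) := by ring_nf
    _ ≤ N * Real.exp (-(η ^ 2 / 2 * N)) := h1
    _ < 1 := by
      rw [Real.exp_neg, ← div_eq_mul_inv, div_lt_one (Real.exp_pos _)]
      exact hNm.trans_le h2

/-! ### The numerical cases -/

/-! In each case `s` is slightly below `R - 1 - √(4 + 12 η)`, the radius from which a candidate
medoid is reached by points of other balls, and `ρ` slightly below `((R - 1)² - 3) / (2 (R - 1))`, the
radius from which points matter to a candidate on the boundary; both are given up to `O(η)`. -/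

theorem recoversBalls_two {d n : ℕ} (hd : 2 ≤ d) (hn : 10 ^ 6 ≤ n) :
    RecoversBalls d 2 n 3.75 := by
  refine recoversBalls_of_bounds (η := 0.01) (ρ := 0.8) (s := 0.71) hd (by norm_num) (by omega)
    ?_ ?_ ?_ ?_ ?_ ?_ ?_ ?_ ?_ ?_ (mul_exp_neg_lt_one (N := 10 ^ 6) (m := 50) ?_ hn ?_ ?_ ?_) <;>
  norm_num

theorem recoversBalls_le_three {d k n : ℕ} (hd : 2 ≤ d) (hk : 1 ≤ k) (hk3 : k ≤ 3)
    (hn : 10 ^ 7 ≤ n) : RecoversBalls d k n 3.8 := by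
  have hk' : (k : ℝ) ≤ 3 := by exact_mod_cast hk3
  refine recoversBalls_of_bounds (η := 0.01) (ρ := 0.84) (s := 0.76) hd hk (by omega)
    ?_ ?_ ?_ ?_ ?_ ?_ ?_ ?_ ?_ ?_ (mul_exp_neg_lt_one (N := 10 ^ 7) (m := 50) ?_ hn ?_ ?_ ?_) <;>
  norm_num
  linarith

theorem recoversBalls_two_of_wide {d n : ℕ} (hd : 2 ≤ d) (hn : 10 ^ 4 ≤ n) :
    RecoversBalls d 2 n 3.9 := by
  refine recoversBalls_of_bounds (η := 0.05) (ρ := 0.83) (s := 0.74) hd (by norm_num) (by omega)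
    ?_ ?_ ?_ ?_ ?_ ?_ ?_ ?_ ?_ ?_ (mul_exp_neg_lt_one (N := 10 ^ 4) (m := 12) ?_ hn ?_ ?_ ?_) <;>
  norm_num

theorem recoversBalls_le_ten {d k n : ℕ} (hd : 2 ≤ d) (hk : 1 ≤ k) (hk10 : k ≤ 10)
    (hn : 10 ^ 7 ≤ n) : RecoversBalls d k n 3.9 := by
  have hk' : (k : ℝ) ≤ 10 := by exact_mod_cast hk10
  refine recoversBalls_of_bounds (η := 0.005) (ρ := 0.92) (s := 0.88) hd hk (by omega)
    ?_ ?_ ?_ ?_ ?_ ?_ ?_ ?_ ?_ ?_ (mul_exp_neg_lt_one (N := 10 ^ 7) (m := 100) ?_ hn ?_ ?_ ?_) <;>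
  norm_num
  linarith

theorem theorem1 (d : ℕ) (hd : 2 ≤ d) (ε : ℝ) (hε : 0 ≤ ε) :
    (∃ k : ℕ, 2 ≤ k ∧ ∃ n₀ : ℕ, ∀ n : ℕ, n₀ ≤ n → RecoversBalls d k n (3.75 + ε)) ∧
    ∀ k n : ℕ, 2 ≤ k → (d : ℝ) ≤ 9 / 8 * (((n : ℝ) - 2) / Real.log n) →
      (10 ^ 6 ≤ n ∧ k = 2) ∨ (0.05 ≤ ε ∧ 10 ^ 7 ≤ n ∧ k ≤ 3) ∨
        (0.15 ≤ ε ∧ 10 ^ 4 ≤ n ∧ k = 2) ∨ (0.15 ≤ ε ∧ 10 ^ 7 ≤ n ∧ k ≤ 10) →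
      RecoversBalls d k n (3.75 + ε) := by
  refine ⟨⟨2, le_rfl, 10 ^ 6, fun n hn => (recoversBalls_two hd hn).mono (by linarith)⟩, ?_⟩
  rintro k n hk - (⟨hn, rfl⟩ | ⟨he, hn, hk3⟩ | ⟨he, hn, rfl⟩ | ⟨he, hn, hk10⟩)
  · exact (recoversBalls_two hd hn).mono (by linarith)
  · exact (recoversBalls_le_three hd (by omega) hk3 hn).mono (by norm_num at *; linarith)
  · exact (recoversBalls_two_of_wide hd hn).mono (by norm_num at *; linarith)
  · exact (recoversBalls_le_ten hd (by omega) hk10 hn).mono (by norm_num at *; linarith)
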